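/- Let $X\subset\mathbb{R}^2$ be a polygonal free space: a compact set with $X=\overline{\operatorname{int}X}$ whose boundary is a finite union of pairwise disjoint simple closed polygons ($X$ may have holes and several connected components). Let $X=\bigcup_{i\in\iota}C_i$ be a convex division of $X$, i.e. $\iota$ is finite, each $C_i$ is a closed convex polygon with nonempty interior, and the interiors of the $C_i$ are pairwise disjoint. The dual graph has node set $\iota$; two nodes $i\ne j$ are neighbours if $C_i\cap C_j$ is a nondegenerate segment (the cutline between $C_i$ and $C_j$), i.e. contains at least two points. A path in $X$ from $a$ to $b$ is a continuous map $f:[0,1]\to X$ with $f(0)=a$ and $f(1)=b$; its length $S(f)\in[0,\infty]$ is the supremum of the Euclidean lengths of inscribed polygonal chains. For $Y\subseteq X$, a path $f$ in $Y$ is globally optimal in $Y$ if $S(f)\le S(g)$ for every path $g$ in $Y$ with the same endpoints. A path passes through the cell $C_i$ if it visits a point of $C_i$ that lies on no cutline of $C_i$. Suppose that the node $i$ has exactly one neighbour in the dual graph and that $x_{init}\notin C_i$ and $x_{goal}\notin C_i$. Then no path from $x_{init}$ to $x_{goal}$ that is globally optimal in $X$ passes through $C_i$. Consequently the cell $C_i$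 can be pruned: a path from $x_{init}$ to $x_{goal}$ is globally optimal in $\bigcup_{j\neq i}C_j$ if and only if it is globally optimal in $X$. -/

import Mathlib

/-- The Euclidean plane. -/
abbrev Plane : Type := EuclideanSpace ℝ (Fin 2)

/-- A simple polygon: the closed polygonal curve running once through its edges, each edge
parametrised over `[0, 1)`, visits no point twice. -/
def IsSimplePolygon {n : ℕ} (P : Polygon Plane n) : Prop :=
  3 ≤ n ∧
    Set.InjOn (fun q : Fin n × ℝ => P.edgePath ℝ q.1 q.2) (Set.univ ×ˢ Set.Ico (0 : ℝ) 1)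

/-- A (closed) polygonal free space: a bounded closed region of the plane, equal to the closure of
its interior, whose boundary consists of finitely many pairwise disjoint simple polygons.
It may have several connected components, and holes. -/
structure IsPolygonalRegion (X : Set Plane) : Prop where
  isCompact : IsCompact X
  closure_interior : closure (interior X) = X
  exists_frontier_eq : ∃ (K : ℕ) (n : Fin K → ℕ) (P : ∀ k, Polygon Plane (n k)),
    (∀ k, IsSimplePolygon (P k)) ∧
    Pairwise (fun k l => Disjoint ((P k).boundary ℝ) ((P l).boundary ℝ)) ∧
    frontier X = ⋃ k, (P k).boundary ℝ

/-- A (closed, nondegenerate) convex polygon. -/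
def IsConvexPolygon (C : Set Plane) : Prop :=
  (∃ V : Set Plane, V.Finite ∧ C = convexHull ℝ V) ∧ (interior C).Nonempty

/-- A convex division of `X`: finitely many convex polygons (the index type is taken to be finite
where this is used) with pairwise disjoint interiors and union `X`. -/
structure IsConvexDivision {ι : Type*} (X : Set Plane) (cell : ι → Set Plane) : Prop where
  isConvexPolygon : ∀ i, IsConvexPolygon (cell i)
  disjoint_interior : Pairwise (fun i j => Disjoint (interior (cell i)) (interior (cell j)))
  iUnion_eq : ⋃ i, cell i = X

/-- The dual (topological) graph of a convex division: the nodes are the cells, and two different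
cells are adjacent when they are separated by a cutline, that is, when their intersection
(a convex set without interior) is a nondegenerate segment and not just a point. -/
def dualGraph {ι : Type*} (cell : ι → Set Plane) : SimpleGraph ι where
  Adj i j := i ≠ j ∧ (cell i ∩ cell j).Nontrivial
  symm := ⟨fun i j h => ⟨h.1.symm, by rw [Set.inter_comm]; exact h.2⟩⟩
  loopless := ⟨fun _ h => h.1 rfl⟩

/-- The path `f` passes through the cell `i`: it visits a point of the (closed) cell that lies on
none of the cutlines of that cell. -/
def PassesThrough {ι : Type*} (cell : ι → Set Plane) {a b : Plane} (f : Path a b) (i : ι) : Prop :=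
  ∃ t, f t ∈ cell i ∧ ∀ j, (dualGraph cell).Adj i j → f t ∉ cell i ∩ cell j

/-- The Euclidean length of a path, as a supremum of lengths of inscribed polygonal chains. -/
noncomputable def pathLength {a b : Plane} (f : Path a b) : ENNReal :=
  eVariationOn f Set.univ

/-- `f` is a globally optimal path in `X`: a path in `X` of least length among all paths in `X`
with the same endpoints. -/
def IsGloballyOptimal (X : Set Plane) {a b : Plane} (f : Path a b) : Prop :=
  (∀ t, f t ∈ X) ∧ ∀ g : Path a b, (∀ t, g t ∈ X) → pathLength f ≤ pathLength g

/-! Let `C` be the cell with the single neighbour `D`, and let `Y` be the union of the cells other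
than `C`. The key fact is `Y ∩ C = D ∩ C` (`IsConvexDivision.mem_neighbor`), which fails for regions
pinched at a point. By `IsPolygonalRegion.exists_inter_near`, a point `p` of `C` and another cell is
approached by further points of `C ∩ Y`; near `p` the cell containing such a point also contains
`p`, hence shares two points with `C`, hence is `D`.

A path visiting `C` off `D` therefore enters and leaves `C` at points of the convex set `D`.
Replacing the excursion by a segment in `D` makes it strictly shorter, provided its length is
finite; chains of segments through cells show that optimal lengths are finite. Hence an optimal path
in `X` stays in `Y`. Conversely, the identity on `Y` glued to the nearest-point projection of `C`
onto `D ∩ C` carries paths in `X` into `Y` without lengthening them, so optimality in `Y` implies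
optimality in `X`. -/

open Set Metric Topology

open scoped unitInterval

/-! ### Local shape of a polygonal boundary -/

/-- A point of the plane is at positive distance from the members of a finite family of closed
sets that do not contain it. -/
lemma exists_ball_avoiding {κ : Type*} [Finite κ] (F : κ → Set Plane)
    (hF : ∀ e, IsClosed (F e)) (p : Plane) :
    ∃ ε > 0, ∀ x, dist x p < ε → ∀ e, x ∈ F e → p ∈ F e := by
  have hc : IsClosed (⋃ e ∈ {e | p ∉ F e}, F e) :=
    (Set.toFinite _).isClosed_biUnion fun e _ => hF e
  have hp : p ∈ (⋃ e ∈ {e | p ∉ F e}, F e)ᶜ := by simp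
  obtain ⟨ε, hε, h⟩ := Metric.isOpen_iff.1 hc.isOpen_compl p hp
  refine ⟨ε, hε, fun x hx e hxe => ?_⟩
  by_contra hpe
  exact h (Metric.mem_ball.2 hx) (mem_biUnion (show e ∈ {e | p ∉ F e} from hpe) hxe)

lemma Polygon.isClosed_edgeSet {n : ℕ} (P : Polygon Plane n) (a : Fin n) :
    IsClosed (P.edgeSet ℝ a) := by
  rw [Polygon.edgeSet_eq_image_edgePath]
  have h : Continuous (P.edgePath ℝ a) := by
    simp only [Polygon.edgePath]
    fun_prop
  exact (isCompact_Icc.image h).isClosed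

lemma Polygon.edgePath_eq {n : ℕ} (P : Polygon Plane n) (a : Fin n) (s t : ℝ) :
    P.edgePath ℝ a t = P.edgePath ℝ a s + (t - s) • (P (finRotate n a) - P a) := by
  simp only [Polygon.edgePath, AffineMap.lineMap_apply_module']
  module

lemma Polygon.edgePath_one {n : ℕ} (P : Polygon Plane n) (a : Fin n) :
    P.edgePath ℝ a 1 = P.edgePath ℝ (finRotate n a) 0 := by
  simp [Polygon.edgePath]

lemma IsSimplePolygon.edge_ne_zero {n : ℕ} {P : Polygon Plane n} (hP : IsSimplePolygon P)
    (a : Fin n) : P (finRotate n a) - P a ≠ 0 := by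
  intro h
  have h1 : P.edgePath ℝ a (1 / 2) = P.edgePath ℝ a 0 := by
    rw [P.edgePath_eq a 0 (1 / 2), h]; simp
  have hne : ((a, 1 / 2) : Fin n × ℝ) = (a, 0) :=
    hP.2 ⟨mem_univ _, by norm_num, by norm_num⟩ ⟨mem_univ _, by norm_num, by norm_num⟩ h1
  have h2 := (Prod.ext_iff.1 hne).2
  norm_num at h2

/-- Near each point, the frontier of a polygonal region lies on two rays issuing from it. -/
lemma IsPolygonalRegion.exists_two_rays {X : Set Plane} (hX : IsPolygonalRegion X) (p : Plane) :
    ∃ v w : Plane, v ≠ 0 ∧ w ≠ 0 ∧ ∃ ε > 0, ∀ x ∈ frontier X, dist x p < ε →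
      (∃ s : ℝ, 0 ≤ s ∧ x = p + s • v) ∨ (∃ s : ℝ, 0 ≤ s ∧ x = p + s • w) := by
  obtain ⟨K, n, P, hsimple, hdisj, hfr⟩ := hX.exists_frontier_eq
  obtain ⟨ε, hε, hε'⟩ := exists_ball_avoiding
    (fun e : Σ k, Fin (n k) => (P e.1).edgeSet ℝ e.2) (fun e => (P e.1).isClosed_edgeSet e.2) p
  have hmem : ∀ x ∈ frontier X, dist x p < ε → ∃ k b, x ∈ (P k).edgeSet ℝ b ∧
      p ∈ (P k).edgeSet ℝ b := by
    intro x hx hd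
    rw [hfr] at hx
    simp only [Polygon.boundary, mem_iUnion] at hx
    obtain ⟨k, b, hb⟩ := hx
    exact ⟨k, b, hb, hε' x hd ⟨k, b⟩ hb⟩
  by_cases hno : ∃ k b, p ∈ (P k).edgeSet ℝ b
  swap
  · obtain ⟨v, hv⟩ := exists_ne (0 : Plane)
    refine ⟨v, v, hv, hv, ε, hε, fun x hx hd => ?_⟩
    obtain ⟨k, b, -, h⟩ := hmem x hx hd
    exact absurd ⟨k, b, h⟩ hno
  -- The end of an edge is read as the start of the next one, so that injectivity on `[0, 1)`
  -- applies.
  obtain ⟨k, a, s, hs, hps⟩ : ∃ k a, ∃ s ∈ Ico (0 : ℝ) 1, (P k).edgePath ℝ a s = p := by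
    obtain ⟨k, b, s, hs, h⟩ := hno
    rcases hs.2.lt_or_eq with h1 | rfl
    · exact ⟨k, b, s, ⟨hs.1, h1⟩, h⟩
    · exact ⟨k, finRotate _ b, 0, by simp, by rw [← Polygon.edgePath_one]; exact h⟩
  have huniq : ∀ l b, p ∈ (P l).edgeSet ℝ b → l = k := by
    intro l b hb
    by_contra hlk
    refine Set.disjoint_left.1 (hdisj hlk) (mem_iUnion.2 ⟨b, hb⟩) (mem_iUnion.2 ⟨a, ?_⟩)
    rw [Polygon.edgeSet_eq_image_edgePath]
    exact ⟨s, Ico_subset_Icc_self hs, hps⟩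
  have hinj : ∀ b, ∀ t ∈ Ico (0 : ℝ) 1, (P k).edgePath ℝ b t = p → b = a ∧ t = s := by
    intro b t ht h
    have hbt : ((b, t) : Fin (n k) × ℝ) = (a, s) :=
      (hsimple k).2 ⟨mem_univ _, ht⟩ ⟨mem_univ _, hs⟩ (h.trans hps.symm)
    exact Prod.ext_iff.1 hbt
  set v := (P k) (finRotate (n k) a) - (P k) a with hv
  have hv0 : v ≠ 0 := (hsimple k).edge_ne_zero a
  set a' := (finRotate (n k)).symm a with ha'
  have hra' : finRotate (n k) a' = a := Equiv.apply_symm_apply _ a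
  set w' := (P k) (finRotate (n k) a') - (P k) a' with hw'
  have hw0 : w' ≠ 0 := (hsimple k).edge_ne_zero a'
  -- One ray runs forward along the edge of `p`; the other runs back along the previous edge if `p`
  -- is a vertex, and back along the same edge otherwise.
  refine ⟨v, if s = 0 then -w' else -v, hv0, by split_ifs <;> simpa, ε, hε, fun x hx hd => ?_⟩
  obtain ⟨l, b, hxb, hpb⟩ := hmem x hx hd
  obtain rfl := huniq l b hpb
  obtain ⟨t, ht, rfl⟩ := hxb
  obtain ⟨s', hs', hps'⟩ := hpb
  change (P l).edgePath ℝ b s' = p at hps'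
  change (∃ s : ℝ, 0 ≤ s ∧ (P l).edgePath ℝ b t = _) ∨
    (∃ s : ℝ, 0 ≤ s ∧ (P l).edgePath ℝ b t = _)
  rcases hs'.2.lt_or_eq with h1 | rfl
  · obtain ⟨rfl, rfl⟩ := hinj b s' ⟨hs'.1, h1⟩ hps'
    have hx' := (P l).edgePath_eq b s' t
    rw [hps, ← hv] at hx'
    rcases le_total s' t with h | h
    · exact Or.inl ⟨t - s', by linarith, hx'⟩
    · by_cases h0 : s' = 0
      · subst h0
        exact Or.inl ⟨t - 0, by linarith [ht.1], hx'⟩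
      · refine Or.inr ⟨s' - t, by linarith, ?_⟩
        rw [if_neg h0, hx']
        module
  · obtain ⟨hba, h0⟩ := hinj _ 0 (by simp) (by rw [← Polygon.edgePath_one]; exact hps')
    have hb : b = a' := ((finRotate (n l)).eq_symm_apply).2 hba
    rw [hb] at hps' ⊢
    have hx' := (P l).edgePath_eq a' 1 t
    rw [hps', ← hw'] at hx'
    refine Or.inr ⟨1 - t, by linarith [ht.2], ?_⟩
    rw [if_pos h0.symm, hx']
    module

/-! ### Small circles and absence of pinch points -/

/-- Parametrisation by the angle of the circle with centre `p` and radius `r`. -/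
noncomputable def circleAt (p : Plane) (r θ : ℝ) : Plane := p + r • !₂[Real.cos θ, Real.sin θ]

lemma continuous_circleAt (p : Plane) (r : ℝ) : Continuous (circleAt p r) := by
  unfold circleAt
  fun_prop

lemma circleAt_periodic (p : Plane) (r : ℝ) : Function.Periodic (circleAt p r) (2 * Real.pi) := by
  intro θ
  simp [circleAt]

lemma dist_circleAt (p : Plane) {r : ℝ} (hr : 0 < r) (θ : ℝ) : dist (circleAt p r θ) p = r := by
  rw [dist_eq_norm, circleAt, add_sub_cancel_left, norm_smul, EuclideanSpace.norm_eq]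
  simp [abs_of_pos hr]

lemma exists_circleAt_eq {p x : Plane} {r : ℝ} (hr : 0 < r) (hx : dist x p = r) :
    ∃ θ, circleAt p r θ = x := by
  have h2 : (x 0 - p 0) ^ 2 + (x 1 - p 1) ^ 2 = r ^ 2 := by
    rw [← hx, EuclideanSpace.dist_eq, Real.sq_sqrt (by positivity)]
    simp [Fin.sum_univ_two, Real.dist_eq]
  set z : ℂ := ⟨x 0 - p 0, x 1 - p 1⟩ with hz
  have hzr : ‖z‖ = r := by
    rw [Complex.norm_def, Complex.normSq_apply, Real.sqrt_eq_iff_mul_self_eq_of_pos hr]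
    simp only [hz]; linarith
  refine ⟨z.arg, ?_⟩
  have hc := Complex.norm_mul_cos_arg z
  have hs := Complex.norm_mul_sin_arg z
  rw [hzr] at hc hs
  ext m
  fin_cases m
  · simpa [circleAt, hc] using by simp [hz]
  · simpa [circleAt, hs] using by simp [hz]

lemma circleAt_ne (p : Plane) {r : ℝ} (hr : 0 < r) {s t : ℝ} (h0 : 0 < s - t)
    (h1 : s - t < 2 * Real.pi) : circleAt p r s ≠ circleAt p r t := by
  intro h
  have h' := smul_right_injective _ hr.ne' (add_left_cancel h)
  have hc : Real.cos s = Real.cos t := by simpa using congrArg (fun y : Plane => y 0) h'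
  have hs : Real.sin s = Real.sin t := by simpa using congrArg (fun y : Plane => y 1) h'
  obtain ⟨k, hk⟩ := Real.Angle.angle_eq_iff_two_pi_dvd_sub.1 (Real.Angle.cos_sin_inj hc hs)
  have hpi := Real.pi_pos
  rw [hk] at h0 h1
  have hk0 : (0 : ℝ) < k := by
    by_contra! hcon
    nlinarith
  have hk1 : (k : ℝ) < 1 := by
    by_contra! hcon
    nlinarith
  have : (0 : ℤ) < k := by exact_mod_cast hk0
  have : k < (1 : ℤ) := by exact_mod_cast hk1
  omega

/-- An open arc that avoids the frontier of `A ∪ B` as well as `A ∩ B`, where `A` and `B` are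
closed, and that meets `A`, has its closure in `A`. -/
lemma arc_subset {A B : Set Plane} (hA : IsClosed A) (hB : IsClosed B) {e : ℝ → Plane}
    (he : Continuous e) {α β : ℝ} (hfr : ∀ t ∈ Ioo α β, e t ∉ frontier (A ∪ B))
    (hAB : ∀ t ∈ Ioo α β, e t ∉ A ∩ B) {t₀ : ℝ} (ht₀ : t₀ ∈ Ioo α β) (h : e t₀ ∈ A) :
    ∀ t ∈ Icc α β, e t ∈ A := by
  have hpre : IsPreconnected (e '' Ioo α β) := isPreconnected_Ioo.image _ he.continuousOn
  have hsub : e '' Ioo α β ⊆ A ∪ B := by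
    have hnot : ∀ t ∈ Ioo α β, e t ∈ A ∪ B → e t ∈ interior (A ∪ B) := fun t ht h => by
      by_contra hi
      exact hfr t ht ⟨subset_closure h, hi⟩
    refine (hpre.subset_left_of_subset_union isOpen_interior (hA.union hB).isOpen_compl
      (disjoint_compl_right.mono_left interior_subset) ?_
      ⟨e t₀, mem_image_of_mem _ ht₀, hnot t₀ ht₀ (Or.inl h)⟩).trans interior_subset
    rintro _ ⟨t, ht, rfl⟩
    by_cases htX : e t ∈ A ∪ B
    · exact Or.inl (hnot t ht htX)
    · exact Or.inr htX
  have hsubA : e '' Ioo α β ⊆ A := by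
    rcases isPreconnected_iff_subset_of_disjoint_closed.1 hpre A B hA hB hsub (by
      rw [Set.eq_empty_iff_forall_notMem]
      rintro _ ⟨⟨t, ht, rfl⟩, hz⟩
      exact hAB t ht hz) with h1 | h1
    · exact h1
    · exact absurd ⟨h, h1 (mem_image_of_mem _ ht₀)⟩ (hAB t₀ ht₀)
  intro t ht
  have hcl : closure (Ioo α β) ⊆ e ⁻¹' A :=
    closure_minimal (fun t ht => hsubA (mem_image_of_mem _ ht)) (hA.preimage he)
  rw [closure_Ioo (ht₀.1.trans ht₀.2).ne] at hcl
  exact hcl ht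

/-- Both arcs into which `q₁` and `q₂` cut the circle have `q₁` as an endpoint, and the closed arc
through `x` stays in `A`. Used with `A` and `B` exchanged as well, this puts `q₁` in `A ∩ B`. -/
lemma mem_of_frontier_inter_circle_subset_pair {A B : Set Plane} (hA : IsClosed A)
    (hB : IsClosed B) {p q₁ q₂ x : Plane} {r : ℝ} (hr : 0 < r) (hq₁ : dist q₁ p = r)
    (hq₂ : dist q₂ p = r) (hfr : ∀ y ∈ frontier (A ∪ B), dist y p = r → y = q₁ ∨ y = q₂)
    (hAB : ∀ y ∈ A ∩ B, dist y p ≠ r) (hxA : x ∈ A) (hx : dist x p = r) (hx₁ : x ≠ q₁)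
    (hx₂ : x ≠ q₂) : q₁ ∈ A := by
  obtain ⟨θ₁, rfl⟩ := exists_circleAt_eq hr hq₁
  obtain ⟨θ₂', rfl⟩ := exists_circleAt_eq hr hq₂
  obtain ⟨t', rfl⟩ := exists_circleAt_eq hr hx
  -- Angles are normalised to one turn from `θ₁`; `q₁` is then the start of the arc before `θ₂` and
  -- the end of the arc after it. If `q₁ = q₂`, the first arc is empty.
  obtain ⟨θ₂, hθ₂, h2⟩ := (circleAt_periodic p r).exists_mem_Ico Real.two_pi_pos θ₂' θ₁
  obtain ⟨t, ht, h3⟩ := (circleAt_periodic p r).exists_mem_Ico Real.two_pi_pos t' θ₁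
  rw [h3] at hx hx₁ hx₂ hxA
  rw [h2] at hfr hq₂ hx₂
  have ht1 : θ₁ < t := lt_of_le_of_ne ht.1 fun h => hx₁ (by rw [h])
  have hcont := continuous_circleAt p r
  rcases lt_trichotomy t θ₂ with h | h | h
  · refine arc_subset hA hB hcont (α := θ₁) (β := θ₂) (fun s hs hs' => ?_)
      (fun s _ hs' => hAB _ hs' (dist_circleAt p hr s)) ⟨ht1, h⟩ hxA θ₁ ⟨le_rfl, hθ₂.1⟩
    rcases hfr _ hs' (dist_circleAt p hr s) with h' | h'
    · exact circleAt_ne p hr (by linarith [hs.1]) (by linarith [hs.2, hθ₂.2]) h'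
    · exact circleAt_ne p hr (by linarith [hs.2]) (by linarith [hs.1, hθ₂.2]) h'.symm
  · exact absurd (by rw [h]) hx₂
  · rw [← circleAt_periodic p r θ₁]
    refine arc_subset hA hB hcont (α := θ₂) (β := θ₁ + 2 * Real.pi) (fun s hs hs' => ?_)
      (fun s _ hs' => hAB _ hs' (dist_circleAt p hr s)) ⟨h, ht.2⟩ hxA _ ⟨hθ₂.2.le, le_rfl⟩
    rcases hfr _ hs' (dist_circleAt p hr s) with h' | h'
    · exact circleAt_ne p hr (by linarith [hs.1, hθ₂.1]) (by linarith [hs.2]) h'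
    · exact circleAt_ne p hr (by linarith [hs.1]) (by linarith [hs.2, hθ₂.1]) h'

open MeasureTheory in
-- Lines are null sets, while a nonempty open set has positive area.
lemma exists_mem_interior_off_lines {C : Set Plane} (hC : (interior C).Nonempty)
    (p v w : Plane) :
    ∃ z ∈ interior C, (∀ s : ℝ, z ≠ p + s • v) ∧ ∀ s : ℝ, z ≠ p + s • w := by
  have hline : ∀ u : Plane, volume (AffineSubspace.mk' p (Submodule.span ℝ {u}) : Set Plane) = 0 :=
    fun u => Measure.addHaar_affineSubspace _ _ fun h => by
      have h1 := congrArg AffineSubspace.direction h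
      rw [AffineSubspace.direction_mk', AffineSubspace.direction_top] at h1
      have h2 := finrank_span_le_card (R := ℝ) ({u} : Set Plane)
      rw [h1, finrank_top] at h2
      simp at h2
  have hpos : 0 < volume (interior C) := isOpen_interior.measure_pos _ hC
  by_contra! hcon
  have hsub : interior C ⊆ (AffineSubspace.mk' p (Submodule.span ℝ {v}) : Set Plane) ∪
      (AffineSubspace.mk' p (Submodule.span ℝ {w}) : Set Plane) := by
    intro z hz
    have hmem : ∀ (u : Plane) (s : ℝ), z = p + s • u →
        z ∈ (AffineSubspace.mk' p (Submodule.span ℝ {u}) : Set Plane) := by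
      rintro u s rfl
      simp [AffineSubspace.mem_mk', Submodule.mem_span_singleton]
    by_cases h : ∀ s : ℝ, z ≠ p + s • v
    · obtain ⟨s, hs⟩ := hcon z hz h
      exact Or.inr (hmem w s hs)
    · push Not at h
      obtain ⟨s, hs⟩ := h
      exact Or.inl (hmem v s hs)
  exact absurd (measure_mono_null hsub (measure_union_null (hline v) (hline w))) hpos.ne'

/-- An interior point off both lines is shrunk towards `p`: convexity keeps it in `C`, and a
homothety centred at `p` preserves lines through `p`. -/
lemma exists_mem_circle_off_rays {C : Set Plane} (hC : Convex ℝ C) (hCi : (interior C).Nonempty)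
    {p : Plane} (hp : p ∈ C) (v w : Plane) :
    ∃ δ > 0, ∀ r : ℝ, 0 < r → r < δ → ∃ x ∈ C, dist x p = r ∧ (∀ s : ℝ, x ≠ p + s • v) ∧
      ∀ s : ℝ, x ≠ p + s • w := by
  obtain ⟨z, hz, hzv, hzw⟩ := exists_mem_interior_off_lines hCi p v w
  have hzp : z - p ≠ 0 := sub_ne_zero.2 (by simpa using hzv 0)
  have hn : 0 < ‖z - p‖ := norm_pos_iff.2 hzp
  refine ⟨‖z - p‖, hn, fun r hr hrδ => ⟨p + (r / ‖z - p‖) • (z - p), ?_, ?_, ?_, ?_⟩⟩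
  · exact hC.add_smul_sub_mem hp (interior_subset hz) ⟨by positivity, by
      rw [div_le_one hn]; exact hrδ.le⟩
  · rw [dist_eq_norm, add_sub_cancel_left, norm_smul, Real.norm_of_nonneg (by positivity),
      div_mul_cancel₀ _ hn.ne']
  all_goals
    intro s hs
    have hs' := add_left_cancel hs
    have h3 : z - p = (‖z - p‖ / r) • ((r / ‖z - p‖) • (z - p)) := by
      rw [smul_smul, div_mul_div_cancel₀ hr.ne', div_self hn.ne', one_smul]
    rw [hs', smul_smul, sub_eq_iff_eq_add'] at h3
    first
    | exact hzv _ h3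
    | exact hzw _ h3

lemma eq_of_mem_ray_of_dist_eq {p v x : Plane} {r s : ℝ} (hv : v ≠ 0) (hs : 0 ≤ s)
    (hx : x = p + s • v) (hr : dist x p = r) : x = p + (r / ‖v‖) • v := by
  have hn : ‖v‖ ≠ 0 := norm_ne_zero_iff.2 hv
  rw [hx, dist_eq_norm, add_sub_cancel_left, norm_smul, Real.norm_of_nonneg hs] at hr
  rw [hx, ← hr, mul_div_cancel_right₀ _ hn]

/-- A polygonal region is not pinched: two closed sets covering it, each containing a
convex body through a common point `p`, meet in further points arbitrarily near `p`. -/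
lemma IsPolygonalRegion.exists_inter_near {A B A' B' : Set Plane}
    (hX : IsPolygonalRegion (A ∪ B)) (hA : IsClosed A) (hB : IsClosed B)
    (hA' : Convex ℝ A') (hAi : (interior A').Nonempty) (hAA : A' ⊆ A)
    (hB' : Convex ℝ B') (hBi : (interior B').Nonempty) (hBB : B' ⊆ B)
    {p : Plane} (hpA : p ∈ A') (hpB : p ∈ B') {ε : ℝ} (hε : 0 < ε) :
    ∃ y ∈ A ∩ B, y ≠ p ∧ dist y p < ε := by
  by_contra! hcon
  obtain ⟨v, w, hv, hw, η, hη, hrays⟩ := hX.exists_two_rays p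
  obtain ⟨δ₁, hδ₁, h₁⟩ := exists_mem_circle_off_rays hA' hAi hpA v w
  obtain ⟨δ₂, hδ₂, h₂⟩ := exists_mem_circle_off_rays hB' hBi hpB v w
  obtain ⟨r, hr, hr'⟩ : ∃ r, 0 < r ∧ r < min (min ε η) (min δ₁ δ₂) :=
    exists_between (by positivity)
  simp only [lt_min_iff] at hr'
  obtain ⟨⟨hrε, hrη⟩, hr₁, hr₂⟩ := hr'
  obtain ⟨x, hxA, hx, hxv, hxw⟩ := h₁ r hr hr₁
  obtain ⟨y, hyB, hy, hyv, hyw⟩ := h₂ r hr hr₂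
  have hq : ∀ u : Plane, u ≠ 0 → dist (p + (r / ‖u‖) • u) p = r := fun u hu => by
    rw [dist_eq_norm, add_sub_cancel_left, norm_smul, Real.norm_of_nonneg (by positivity),
      div_mul_cancel₀ _ (norm_ne_zero_iff.2 hu)]
  have hfr : ∀ y ∈ frontier (A ∪ B), dist y p = r →
      y = p + (r / ‖v‖) • v ∨ y = p + (r / ‖w‖) • w := by
    intro y hy hyr
    rcases hrays y hy (hyr.trans_lt hrη) with ⟨s, hs, h⟩ | ⟨s, hs, h⟩
    · exact Or.inl (eq_of_mem_ray_of_dist_eq hv hs h hyr)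
    · exact Or.inr (eq_of_mem_ray_of_dist_eq hw hs h hyr)
  have hAB : ∀ y ∈ A ∩ B, dist y p ≠ r := by
    intro y hy hyr
    have hyp : y ≠ p := by
      rintro rfl
      rw [dist_self] at hyr
      exact hr.ne hyr
    exact absurd (hcon y hy hyp) (by rw [hyr]; exact not_le.2 hrε)
  have hqA := mem_of_frontier_inter_circle_subset_pair hA hB hr (hq v hv) (hq w hw) hfr hAB
    (hAA hxA) hx (hxv _) (hxw _)
  have hqB := mem_of_frontier_inter_circle_subset_pair hB hA hr (hq v hv) (hq w hw)
    (by rwa [union_comm]) (by rwa [inter_comm]) (hBB hyB) hy (hyv _) (hyw _)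
  exact hAB _ ⟨hqA, hqB⟩ (hq v hv)

/-! ### Path length, finiteness and shortcuts -/

lemma eVariationOn_lineMap_comp_le {α : Type*} [LinearOrder α] (x y : Plane) {φ : α → ℝ}
    {u w : α} (huw : u ≤ w) (hφ : MonotoneOn φ (Icc u w)) :
    eVariationOn (fun t => AffineMap.lineMap x y (φ t) : α → Plane) (Icc u w) ≤
      edist x y * ENNReal.ofReal (φ w - φ u) := by
  have hL := (lipschitzWith_lineMap (𝕜 := ℝ) x y).lipschitzOnWith (s := univ)
  refine (hL.comp_eVariationOn_le (mapsTo_univ φ _)).trans ?_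
  rw [edist_nndist]
  gcongr
  have h := hφ.eVariationOn_eq (left_mem_Icc.2 huw) (right_mem_Icc.2 huw)
  rw [inter_self] at h
  exact h.le

lemma pathLength_eq_Icc {a b : Plane} (f : Path a b) (u : I) :
    pathLength f = eVariationOn f (Icc 0 u) + eVariationOn f (Icc u 1) := by
  have h := eVariationOn.Icc_add_Icc f (s := univ) (a := (0 : I)) (b := u) (c := 1)
    unitInterval.nonneg' unitInterval.le_one' (mem_univ u)
  simp only [univ_inter] at h
  rw [h, pathLength]
  congr
  ext t
  simp [unitInterval.le_one']

lemma pathLength_segment_ne_top (a b : Plane) : pathLength (Path.segment a b) ≠ ⊤ := by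
  have h := eVariationOn_lineMap_comp_le a b (φ := fun t : I => (t : ℝ)) (u := 0) (w := 1)
    unitInterval.nonneg' (Subtype.mono_coe _ |>.monotoneOn _)
  have h1 : (Icc 0 1 : Set I) = univ := by
    ext t
    simp [unitInterval.le_one']
  rw [h1] at h
  refine ne_top_of_le_ne_top ?_ h
  exact ENNReal.mul_ne_top (edist_ne_top _ _) ENNReal.ofReal_ne_top

lemma pathLength_trans_le {a b c : Plane} (f : Path a b) (g : Path b c) :
    pathLength (f.trans g) ≤ pathLength f + pathLength g := by
  set h : I := ⟨1 / 2, by norm_num, by norm_num⟩ with hh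
  rw [pathLength_eq_Icc _ h]
  have hpr : Monotone (projIcc (0 : ℝ) 1 zero_le_one) := monotone_projIcc _
  refine add_le_add ?_ ?_
  · have heq : EqOn (f.trans g) (f ∘ fun t : I => projIcc (0 : ℝ) 1 zero_le_one (2 * t))
        (Icc 0 h) := by
      intro t ht
      have : (t : ℝ) ≤ 1 / 2 := ht.2
      simp only [Path.trans, Path.coe_mk_mk, Function.comp_apply, if_pos this]
      rfl
    rw [eVariationOn.congr heq]
    refine eVariationOn.comp_le_of_monotoneOn f _ (fun s _ t _ hst => hpr ?_) (mapsTo_univ _ _)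
    have : (s : ℝ) ≤ t := hst
    linarith
  · have heq : EqOn (f.trans g) (g ∘ fun t : I => projIcc (0 : ℝ) 1 zero_le_one (2 * t - 1))
        (Icc h 1) := by
      intro t ht
      have h1 : (1 / 2 : ℝ) ≤ t := ht.1
      rcases h1.eq_or_lt with h2 | h2
      · simp [Path.trans, ← h2]
      · simp only [Path.trans, Path.coe_mk_mk, Function.comp_apply, if_neg (not_le.2 h2)]
        rfl
    rw [eVariationOn.congr heq]
    refine eVariationOn.comp_le_of_monotoneOn g _ (fun s _ t _ hst => hpr ?_) (mapsTo_univ _ _)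
    have : (s : ℝ) ≤ t := hst
    linarith

/-- Two points joined by a path in a finite union of closed convex sets are joined by a path of
finite length there. -/
lemma exists_path_pathLength_ne_top {κ : Type*} [Finite κ] (F : κ → Set Plane)
    (hF : ∀ i, IsClosed (F i)) (hconv : ∀ i, Convex ℝ (F i)) {a b : Plane} (f : Path a b)
    (hf : ∀ t, f t ∈ ⋃ i, F i) :
    ∃ g : Path a b, (∀ t, g t ∈ ⋃ i, F i) ∧ pathLength g ≠ ⊤ := by
  set R : Plane → Plane → Prop := fun x y => ∃ i, x ∈ F i ∧ y ∈ F i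
  have hab : ∀ t, Relation.ReflTransGen R a (f t) := by
    -- Reachability is constant on each `F i`, so the reachable times and their complement are both
    -- preimages of finite unions of closed sets.
    set S : Set κ := {i | ∃ x ∈ F i, Relation.ReflTransGen R a x} with hS
    set T : Set I := {t | Relation.ReflTransGen R a (f t)} with hT
    have hT1 : T = f ⁻¹' ⋃ i ∈ S, F i := by
      ext t
      simp only [hT, hS, mem_preimage, mem_iUnion, mem_ofPred_eq, exists_prop]
      constructor
      · intro h
        obtain ⟨i, hi⟩ := mem_iUnion.1 (hf t)
        exact ⟨i, ⟨f t, hi, h⟩, hi⟩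
      · rintro ⟨i, ⟨x, hx, h⟩, hi⟩
        exact h.tail ⟨i, hx, hi⟩
    have hT2 : Tᶜ = f ⁻¹' ⋃ i ∈ Sᶜ, F i := by
      ext t
      simp only [hT, hS, mem_preimage, mem_iUnion, mem_compl_iff, mem_ofPred_eq, exists_prop]
      constructor
      · intro h
        obtain ⟨i, hi⟩ := mem_iUnion.1 (hf t)
        exact ⟨i, fun ⟨x, hx, h'⟩ => h (h'.tail ⟨i, hx, hi⟩), hi⟩
      · rintro ⟨i, hn, hi⟩ h
        exact hn ⟨f t, hi, h⟩
    have hcl : IsClopen T := by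
      refine ⟨?_, ?_⟩
      · rw [hT1]
        exact ((Set.toFinite _).isClosed_biUnion fun i _ => hF i).preimage f.continuous
      · rw [← isClosed_compl_iff, hT2]
        exact ((Set.toFinite _).isClosed_biUnion fun i _ => hF i).preimage f.continuous
    have h0 : (0 : I) ∈ T := by
      simp only [hT, mem_ofPred_eq, f.source]
      exact Relation.ReflTransGen.refl
    have := hcl.eq_univ ⟨0, h0⟩
    intro t
    exact (this ▸ mem_univ t : t ∈ T)
  have hchain : ∀ y, Relation.ReflTransGen R a y →
      ∃ g : Path a y, (∀ t, g t ∈ ⋃ i, F i) ∧ pathLength g ≠ ⊤ := by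
    intro y hy
    induction hy with
    | refl =>
      refine ⟨Path.refl a, fun t => ?_, ?_⟩
      · have := hf 0
        rwa [f.source] at this
      · have : pathLength (Path.refl a) = 0 :=
          (eVariationOn.eq_zero_iff _).2 (by intro s _ t _; exact edist_self a)
        rw [this]
        exact ENNReal.zero_ne_top
    | @tail y z _ hyz ih =>
      obtain ⟨g, hg, hgl⟩ := ih
      obtain ⟨i, hyi, hzi⟩ := hyz
      refine ⟨g.trans (Path.segment y z), fun t => ?_, ne_top_of_le_ne_top
        (ENNReal.add_ne_top.2 ⟨hgl, pathLength_segment_ne_top y z⟩) (pathLength_trans_le _ _)⟩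
      have ht : g.trans (Path.segment y z) t ∈ range g ∪ range (Path.segment y z) := by
        rw [← Path.trans_range]
        exact mem_range_self t
      rcases ht with ⟨s, hs⟩ | ⟨s, hs⟩
      · exact hs ▸ hg s
      · rw [← hs]
        refine mem_iUnion.2 ⟨i, (hconv i).segment_subset hyi hzi ?_⟩
        rw [segment_eq_image_lineMap]
        exact ⟨s, s.2, rfl⟩
  have := hab 1
  rw [f.target] at this
  exact hchain b this

/-- Replacing a part of a path of finite length by a segment makes it strictly shorter if that
part leaves the segment. -/
lemma exists_path_pathLength_lt {a b : Plane} (f : Path a b) (hf : pathLength f ≠ ⊤) {u t₀ w : I}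
    (hu : u ≤ t₀) (hw : t₀ ≤ w) (ht₀ : f t₀ ∉ segment ℝ (f u) (f w)) :
    ∃ g : Path a b, (∀ t, g t ∈ range f ∪ segment ℝ (f u) (f w)) ∧
      pathLength g < pathLength f := by
  have hut : u < t₀ := lt_of_le_of_ne hu fun h => ht₀ (h ▸ left_mem_segment ℝ _ _)
  have huw : u < w := hut.trans_le hw
  have huw' : (0 : ℝ) < w - u := sub_pos.2 huw
  set φ : I → ℝ := fun t => ((t : ℝ) - u) / (w - u) with hφ
  have hφu : φ u = 0 := by simp [hφ]
  have hφw : φ w = 1 := div_self huw'.ne'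
  have hφc : Continuous φ := by fun_prop
  have hφm : Monotone φ := fun s t hst => by
    have : (s : ℝ) ≤ t := hst
    simp only [hφ]
    gcongr
  set G : I → Plane := fun t =>
    if t ≤ u then f t else if t ≤ w then AffineMap.lineMap (f u) (f w) (φ t) else f t with hG
  have hGl : EqOn G f (Icc 0 u) := fun t ht => if_pos ht.2
  have hGm : EqOn G (fun t => AffineMap.lineMap (f u) (f w) (φ t)) (Icc u w) := by
    intro t ht
    rcases ht.1.eq_or_lt with rfl | h
    · simp [hG, hφu]
    · simp [hG, not_le.2 h, ht.2]
  have hGr : EqOn G f (Icc w 1) := by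
    intro t ht
    rcases ht.1.eq_or_lt with rfl | h
    · simp [hG, not_le.2 huw, hφw]
    · simp [hG, not_le.2 h, not_le.2 (huw.trans h)]
  have hGc : Continuous G := by
    refine Continuous.if_le f.continuous (Continuous.if_le ?_ f.continuous continuous_id
      continuous_const ?_) continuous_id continuous_const ?_
    · simp only [AffineMap.lineMap_apply_module']
      fun_prop
    · rintro t rfl
      simp [hφw]
    · rintro t rfl
      simp [huw.le, hφu]
  refine ⟨⟨⟨G, hGc⟩, ?_, ?_⟩, fun t => ?_, ?_⟩
  · change G 0 = a
    rw [hGl ⟨le_rfl, unitInterval.nonneg'⟩, f.source]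
  · change G 1 = b
    rw [hGr ⟨unitInterval.le_one', le_rfl⟩, f.target]
  · change G t ∈ _
    rcases le_total t u with h | h
    · exact Or.inl ⟨t, (hGl ⟨unitInterval.nonneg', h⟩).symm⟩
    rcases le_total t w with h' | h'
    · rw [hGm ⟨h, h'⟩, segment_eq_image_lineMap]
      exact Or.inr ⟨φ t, ⟨hφu ▸ hφm h, hφw ▸ hφm h'⟩, rfl⟩
    · exact Or.inl ⟨t, (hGr ⟨h', unitInterval.le_one'⟩).symm⟩
  · have hsplit : ∀ F : I → Plane, eVariationOn F (Icc u 1) =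
        eVariationOn F (Icc u w) + eVariationOn F (Icc w 1) := fun F => by
      have h := eVariationOn.Icc_add_Icc F (s := univ) huw.le
        (unitInterval.le_one' : w ≤ 1) (mem_univ w)
      simpa only [univ_inter] using h.symm
    rw [pathLength_eq_Icc _ u, pathLength_eq_Icc f u, hsplit, hsplit]
    change eVariationOn G _ + (eVariationOn G _ + eVariationOn G _) < _
    rw [pathLength_eq_Icc f u, hsplit] at hf
    simp only [ENNReal.add_ne_top, ne_eq] at hf
    rw [eVariationOn.congr hGl, eVariationOn.congr hGr, eVariationOn.congr hGm]
    refine ENNReal.add_lt_add_left hf.1 (ENNReal.add_lt_add_right hf.2.2 ?_)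
    have h1 := eVariationOn_lineMap_comp_le (f u) (f w) huw.le (hφm.monotoneOn _)
    rw [hφu, hφw, sub_zero, ENNReal.ofReal_one, mul_one] at h1
    refine h1.trans_lt ?_
    -- Strict convexity of the norm: equality in the triangle inequality would put `f t₀` on the
    -- segment.
    have h2 : edist (f u) (f w) < edist (f u) (f t₀) + edist (f t₀) (f w) := by
      rw [edist_dist, edist_dist, edist_dist, ← ENNReal.ofReal_add dist_nonneg dist_nonneg]
      refine (ENNReal.ofReal_lt_ofReal_iff_of_nonneg dist_nonneg).2 ?_
      refine lt_of_le_of_ne (dist_triangle _ _ _) fun h => ht₀ ?_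
      exact mem_segment_iff_wbtw.2 (dist_add_dist_eq_iff.1 h.symm)
    refine h2.trans_le ?_
    have h3 := eVariationOn.Icc_add_Icc f (s := univ) hu hw (mem_univ t₀)
    simp only [univ_inter] at h3
    rw [← h3]
    exact add_le_add (eVariationOn.edist_le f (left_mem_Icc.2 hu) (right_mem_Icc.2 hu))
      (eVariationOn.edist_le f (left_mem_Icc.2 hw) (right_mem_Icc.2 hw))

/-! ### Retraction by nearest-point projection -/

open scoped RealInnerProductSpace in
/-- The nearest-point projection to a nonempty closed convex set. -/
lemma exists_nearest_point_projection {K : Set Plane} (hne : K.Nonempty) (hcl : IsClosed K)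
    (hconv : Convex ℝ K) :
    ∃ π : Plane → Plane, (∀ x, π x ∈ K) ∧ (∀ x ∈ K, π x = x) ∧ LipschitzWith 1 π := by
  have h : ∀ x : Plane, ∃ y ∈ K, ∀ z ∈ K, ⟪x - y, z - y⟫ ≤ 0 := fun x => by
    obtain ⟨y, hy, hxy⟩ := exists_norm_eq_iInf_of_complete_convex hne hcl.isComplete hconv x
    exact ⟨y, hy, (norm_eq_iInf_iff_real_inner_le_zero hconv hy).1 hxy⟩
  choose π hπ hin using h
  refine ⟨π, hπ, fun x hx => ?_, LipschitzWith.of_dist_le_mul fun x y => ?_⟩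
  · have h := hin x x hx
    rw [real_inner_self_eq_norm_sq] at h
    have h0 : ‖x - π x‖ = 0 := pow_eq_zero_iff two_ne_zero |>.1 (h.antisymm (sq_nonneg _))
    exact (sub_eq_zero.1 (norm_eq_zero.1 h0)).symm
  · have h1 := hin x _ (hπ y)
    have h2 := hin y _ (hπ x)
    -- The sum of the variational inequalities at `π x` and `π y`; Cauchy–Schwarz then gives the
    -- Lipschitz bound.
    have h3 : ‖π x - π y‖ ^ 2 ≤ ⟪x - y, π x - π y⟫ := by
      rw [← real_inner_self_eq_norm_sq]
      simp only [inner_sub_left, inner_sub_right] at *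
      linarith
    have h4 := real_inner_le_norm (x - y) (π x - π y)
    rw [dist_eq_norm, dist_eq_norm, NNReal.coe_one, one_mul]
    by_contra! hcon
    nlinarith [norm_nonneg (x - y)]

/-- If two closed sets meet in a convex set, paths in their union can be retracted to the first
one without getting longer. -/
lemma exists_path_pathLength_le {Y C : Set Plane} (hY : IsClosed Y) (hC : IsClosed C)
    (hne : (Y ∩ C).Nonempty) (hconv : Convex ℝ (Y ∩ C)) {a b : Plane} (ha : a ∈ Y) (hb : b ∈ Y)
    (g : Path a b) (hg : ∀ t, g t ∈ Y ∪ C) :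
    ∃ g' : Path a b, (∀ t, g' t ∈ Y) ∧ pathLength g' ≤ pathLength g := by
  classical
  obtain ⟨π, hπ, hfix, hlip⟩ := exists_nearest_point_projection hne (hY.inter hC) hconv
  set ρ : Plane → Plane := fun x => if x ∈ Y then x else π x with hρ
  have hρY : EqOn ρ id Y := fun x hx => if_pos hx
  have hρC : EqOn ρ π C := fun x hx => by
    by_cases h : x ∈ Y
    · simp [hρ, h, hfix x ⟨h, hx⟩]
    · simp [hρ, h]
  have hρc : ContinuousOn ρ (Y ∪ C) :=
    (continuousOn_id.congr hρY).union_of_isClosed (hlip.continuous.continuousOn.congr hρC) hY hC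
  have hGc : Continuous (fun t => ρ (g t)) := hρc.comp_continuous g.continuous hg
  have hπe : ∀ x y, edist (π x) (π y) ≤ edist x y := fun x y => by
    simpa using hlip.edist_le_mul x y
  have hbetween : ∀ s t : I, s ≤ t → (∃ x ∈ Icc s t, g x ∈ Y) → (∃ x ∈ Icc s t, g x ∈ C) →
      ∃ x ∈ Icc s t, g x ∈ Y ∩ C := by
    rintro s t - ⟨x, hx, hxY⟩ ⟨y, hy, hyC⟩
    exact isPreconnected_closed_iff.1 isPreconnected_Icc (g ⁻¹' Y) (g ⁻¹' C)
      (hY.preimage g.continuous) (hC.preimage g.continuous) (fun z _ => hg z) ⟨x, hx, hxY⟩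
      ⟨y, hy, hyC⟩
  -- Since `Y` and `C` may be joined only around a corner, `ρ` need not contract chords. The bound
  -- is by the variation of `g`, which must cross `Y ∩ C` between a time in `Y` and a time in `C`.
  have hstep : ∀ s t : I, s ≤ t → edist (ρ (g s)) (ρ (g t)) ≤ eVariationOn g (Icc s t) := by
    intro s t hst
    have hs := left_mem_Icc.2 hst
    have ht := right_mem_Icc.2 hst
    have hvia : ∀ x ∈ Icc s t, edist (g s) (g x) + edist (g x) (g t) ≤
        eVariationOn g (Icc s t) := fun x hx => by
      have h3 := eVariationOn.Icc_add_Icc g (s := univ) hx.1 hx.2 (mem_univ x)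
      simp only [univ_inter] at h3
      rw [← h3]
      exact add_le_add (eVariationOn.edist_le g (left_mem_Icc.2 hx.1) (right_mem_Icc.2 hx.1))
        (eVariationOn.edist_le g (left_mem_Icc.2 hx.2) (right_mem_Icc.2 hx.2))
    have hYY : ∀ x y, x ∈ Y → y ∈ Y → edist (ρ x) (ρ y) ≤ edist x y := fun x y hx hy => by
      rw [hρY hx, hρY hy]; rfl
    have hCC : ∀ x y, x ∈ C → y ∈ C → edist (ρ x) (ρ y) ≤ edist x y := fun x y hx hy => by
      rw [hρC hx, hρC hy]; exact hπe x y
    rcases hg s with h1 | h1 <;> rcases hg t with h2 | h2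
    · exact (hYY _ _ h1 h2).trans (eVariationOn.edist_le g hs ht)
    · obtain ⟨x, hx, hxY, hxC⟩ := hbetween s t hst ⟨s, hs, h1⟩ ⟨t, ht, h2⟩
      exact (edist_triangle _ (ρ (g x)) _).trans
        ((add_le_add (hYY _ _ h1 hxY) (hCC _ _ hxC h2)).trans (hvia x hx))
    · obtain ⟨x, hx, hxY, hxC⟩ := hbetween s t hst ⟨t, ht, h2⟩ ⟨s, hs, h1⟩
      exact (edist_triangle _ (ρ (g x)) _).trans
        ((add_le_add (hCC _ _ h1 hxC) (hYY _ _ hxY h2)).trans (hvia x hx))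
    · exact (hCC _ _ h1 h2).trans (eVariationOn.edist_le g hs ht)
  refine ⟨⟨⟨fun t => ρ (g t), hGc⟩, ?_, ?_⟩, fun t => ?_, ?_⟩
  · change ρ (g 0) = a
    rw [g.source]; exact hρY ha
  · change ρ (g 1) = b
    rw [g.target]; exact hρY hb
  · change ρ (g t) ∈ Y
    by_cases h : g t ∈ Y
    · rw [hρY h]; exact h
    · simpa only [hρ, if_neg h] using (hπ _).1
  · refine iSup_le ?_
    rintro ⟨n, u, hu, -⟩
    calc _ ≤ ∑ k ∈ Finset.range n, eVariationOn g (Icc (u k) (u (k + 1))) := by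
          refine Finset.sum_le_sum fun k _ => ?_
          rw [edist_comm]
          exact hstep _ _ (hu k.le_succ)
      _ = eVariationOn g (Icc (u 0) (u n)) := eVariationOn.sum' g hu
      _ ≤ pathLength g := eVariationOn.mono g (subset_univ _)

/-! ### Cells with a single neighbour -/

lemma IsConvexPolygon.convex {C : Set Plane} (h : IsConvexPolygon C) : Convex ℝ C := by
  obtain ⟨⟨V, -, rfl⟩, -⟩ := h
  exact convex_convexHull ℝ V

lemma IsConvexPolygon.isClosed {C : Set Plane} (h : IsConvexPolygon C) : IsClosed C := by
  obtain ⟨⟨V, hV, rfl⟩, -⟩ := h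
  exact hV.isClosed_convexHull ℝ

/-- A cell of a convex division of a polygonal region with exactly one neighbour meets the other
cells only in that neighbour. -/
lemma IsConvexDivision.mem_neighbor {ι : Type*} [Finite ι] {X : Set Plane}
    (hX : IsPolygonalRegion X) {cell : ι → Set Plane} (hcell : IsConvexDivision X cell)
    {i j : ι} (hj : ∀ k, (dualGraph cell).Adj i k → k = j) {k : ι} (hk : k ≠ i) {p : Plane}
    (hpi : p ∈ cell i) (hpk : p ∈ cell k) : p ∈ cell j := by
  by_contra hpj
  set Y : Set Plane := ⋃ m ∈ {m | m ≠ i}, cell m with hY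
  have hXY : cell i ∪ Y = X := by
    rw [← hcell.iUnion_eq, hY]
    ext x
    simp only [mem_union, mem_iUnion, mem_ofPred_eq, exists_prop]
    refine ⟨?_, ?_⟩
    · rintro (h | ⟨m, -, h⟩)
      exacts [⟨i, h⟩, ⟨m, h⟩]
    · rintro ⟨m, h⟩
      by_cases hm : m = i
      · exact Or.inl (hm ▸ h)
      · exact Or.inr ⟨m, hm, h⟩
  have hcl : ∀ m, IsClosed (cell m) := fun m => (hcell.isConvexPolygon m).isClosed
  obtain ⟨ε, hε, hε'⟩ := exists_ball_avoiding cell hcl p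
  obtain ⟨y, ⟨hyi, hyY⟩, hyp, hyε⟩ := IsPolygonalRegion.exists_inter_near (hXY ▸ hX) (hcl i)
    ((Set.toFinite _).isClosed_biUnion fun m _ => hcl m) (hcell.isConvexPolygon i).convex
    (hcell.isConvexPolygon i).2 Subset.rfl (hcell.isConvexPolygon k).convex
    (hcell.isConvexPolygon k).2 (subset_biUnion_of_mem (u := cell) (show k ∈ {m | m ≠ i} from hk))
    hpi hpk hε
  simp only [mem_iUnion, mem_ofPred_eq, exists_prop] at hyY
  obtain ⟨m, hm, hym⟩ := hyY
  -- `y` is so close to `p` that its cell contains `p` too; the two distinct common points make that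
  -- cell a neighbour of `i`.
  have hpm := hε' y hyε m hym
  have hmj := hj m ⟨hm.symm, y, ⟨hyi, hym⟩, p, ⟨hpi, hpm⟩, hyp⟩
  exact hpj (hmj ▸ hpm)

theorem mainTheorem8 {ι : Type*} [Finite ι] (X : Set Plane) (hX : IsPolygonalRegion X)
    (cell : ι → Set Plane) (hcell : IsConvexDivision X cell)
    (i : ι) (hi : ∃! j, (dualGraph cell).Adj i j)
    (x_init x_goal : Plane) (hinit : x_init ∉ cell i) (hgoal : x_goal ∉ cell i) :
    (∀ f : Path x_init x_goal, IsGloballyOptimal X f → ¬ PassesThrough cell f i) ∧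
    (∀ f : Path x_init x_goal,
      IsGloballyOptimal (⋃ j ∈ {j : ι | j ≠ i}, cell j) f ↔ IsGloballyOptimal X f) := by
  obtain ⟨j, hij, hj⟩ := hi
  have hcl : ∀ m, IsClosed (cell m) := fun m => (hcell.isConvexPolygon m).isClosed
  have hcv : ∀ m, Convex ℝ (cell m) := fun m => (hcell.isConvexPolygon m).convex
  set Y : Set Plane := ⋃ m ∈ {m | m ≠ i}, cell m with hY
  have hYmem : ∀ x, x ∈ Y ↔ ∃ m, m ≠ i ∧ x ∈ cell m := fun x => by simp [hY]
  have hYcl : IsClosed Y := (Set.toFinite _).isClosed_biUnion fun m _ => hcl m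
  have hYX : Y ⊆ X := fun x hx => by
    obtain ⟨m, -, h⟩ := (hYmem x).1 hx
    exact hcell.iUnion_eq ▸ mem_iUnion.2 ⟨m, h⟩
  have hXY : X ⊆ Y ∪ cell i := fun x hx => by
    rw [← hcell.iUnion_eq] at hx
    obtain ⟨m, h⟩ := mem_iUnion.1 hx
    by_cases hm : m = i
    · exact Or.inr (hm ▸ h)
    · exact Or.inl ((hYmem x).2 ⟨m, hm, h⟩)
  have hcellX : ∀ m, cell m ⊆ X := fun m => hcell.iUnion_eq ▸ subset_iUnion cell m
  have hjY : cell j ⊆ Y := fun x hx => (hYmem x).2 ⟨j, hij.1.symm, hx⟩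
  have hYi : Y ∩ cell i = cell j ∩ cell i := by
    ext x
    refine ⟨fun ⟨h, hxi⟩ => ?_, fun ⟨h, hxi⟩ => ⟨hjY h, hxi⟩⟩
    obtain ⟨m, hm, hxm⟩ := (hYmem x).1 h
    exact ⟨hcell.mem_neighbor hX hj hm hxi hxm, hxi⟩
  have hmain : ∀ f : Path x_init x_goal, IsGloballyOptimal X f → ∀ t, f t ∈ cell i →
      f t ∈ cell j := by
    rintro f ⟨hfX, hopt⟩ t₀ hti
    by_contra htj
    have hfY : IsClosed (f ⁻¹' Y) := hYcl.preimage f.continuous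
    have htY : f t₀ ∉ Y := fun h => htj (hYi ▸ ⟨h, hti⟩ : f t₀ ∈ cell j ∩ cell i).1
    have h0 : f 0 ∈ Y := (hXY (hfX 0)).resolve_right (by rwa [f.source])
    have h1 : f 1 ∈ Y := (hXY (hfX 1)).resolve_right (by rwa [f.target])
    have hmeet : ∀ s t : I, s ≤ t → (∃ x ∈ Icc s t, f x ∈ Y) → (∃ x ∈ Icc s t, f x ∈ cell i) →
        ∃ x ∈ Icc s t, f x ∈ Y ∩ cell i := by
      rintro s t - ⟨x, hx, hxY⟩ ⟨y, hy, hyC⟩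
      exact isPreconnected_closed_iff.1 isPreconnected_Icc (f ⁻¹' Y) (f ⁻¹' cell i)
        hfY ((hcl i).preimage f.continuous) (fun z _ => hXY (hfX z)) ⟨x, hx, hxY⟩ ⟨y, hy, hyC⟩
    obtain ⟨u, hu, huK⟩ := hmeet 0 t₀ unitInterval.nonneg' ⟨0, ⟨le_rfl, unitInterval.nonneg'⟩, h0⟩
      ⟨t₀, ⟨unitInterval.nonneg', le_rfl⟩, hti⟩
    obtain ⟨w, hw, hwK⟩ := hmeet t₀ 1 unitInterval.le_one' ⟨1, ⟨unitInterval.le_one', le_rfl⟩, h1⟩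
      ⟨t₀, ⟨le_rfl, unitInterval.le_one'⟩, hti⟩
    rw [hYi] at huK hwK
    have hseg : segment ℝ (f u) (f w) ⊆ cell j := (hcv j).segment_subset huK.1 hwK.1
    -- Comparison with a path of finite length makes the length of `f` finite, without which the
    -- shortcut would not be strict.
    obtain ⟨g₀, hg₀X, hg₀⟩ := exists_path_pathLength_ne_top cell hcl hcv f
      (fun t => by rw [hcell.iUnion_eq]; exact hfX t)
    rw [hcell.iUnion_eq] at hg₀X
    obtain ⟨g, hgX, hg⟩ := exists_path_pathLength_lt f (ne_top_of_le_ne_top hg₀ (hopt g₀ hg₀X))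
      hu.2 hw.1 (fun h => htj (hseg h))
    refine absurd (hopt g fun t => ?_) (not_le.2 hg)
    rcases hgX t with ⟨s, hs⟩ | h
    · exact hs ▸ hfX s
    · exact hcellX j (hseg h)
  refine ⟨fun f hf ⟨t, hti, hnot⟩ => hnot j hij ⟨hti, hmain f hf t hti⟩, fun f => ⟨?_, ?_⟩⟩
  · rintro ⟨hfY, hopt⟩
    refine ⟨fun t => hYX (hfY t), fun g hg => ?_⟩
    have h0 := hfY 0
    have h1 := hfY 1
    rw [f.source] at h0
    rw [f.target] at h1
    obtain ⟨g', hg'Y, hg'⟩ := exists_path_pathLength_le hYcl (hcl i)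
      (by rw [hYi, inter_comm]; exact hij.2.nonempty)
      (by rw [hYi]; exact (hcv j).inter (hcv i)) h0 h1 g (fun t => hXY (hg t))
    exact (hopt g' hg'Y).trans hg'
  · rintro hf
    refine ⟨fun t => ?_, fun g hg => hf.2 g fun t => hYX (hg t)⟩
    rcases hXY (hf.1 t) with h | h
    · exact h
    · exact hjY (hmain f hf t h)
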